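/- Let $I=[0,1]$ and let $PL_+(I)$ be the group, under composition, of all orientation preserving piecewise linear homeomorphisms of $I$ (acting on $I$ from the right). For $g\in PL_+(I)$ let $\operatorname{supp}(g)=\{x\in I: xg\neq x\}$, and for $G\le PL_+(I)$ let $\operatorname{supp} G=\bigcup_{g\in G}\operatorname{supp}(g)$. A group $G$ acting by homeomorphisms on a topological space $X$ acts in a locally dense manner if $X$ has no isolated points and, whenever $x\in U\subseteq X$ with $U$ open, the set $\{xg : g\in G,\ \operatorname{supp}(g)\subseteq U\}$ is somewhere dense in $X$ (its closure has nonempty interior). Suppose that $G,H\le PL_+(I)$ are nontrivial and that each acts on its support in a locally dense manner. If $\phi:G\to H$ is an isomorphism of groups, then there is a unique homeomorphism $\psi:\operatorname{supp}G\to\operatorname{supp}H$ such that $\psi(xg)=\psi(x)\phi(g)$ for all $x\in\operatorname{supp}G$ and all $g\in G$. -/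

import Mathlib

open scoped unitInterval

/-- A self-map `f` of `I = [0,1]` is piecewise linear if there is a finite set `S` of points such that
`f` is affine on every closed interval whose interior contains no point of `S`. -/
def IsPiecewiseLinear (f : I → I) : Prop :=
  ∃ S : Set I, S.Finite ∧ ∀ a b : I, a ≤ b → Disjoint (Set.Ioo a b) S →
    ∃ m c : ℝ, ∀ x ∈ Set.Icc a b, (f x : ℝ) = m * (x : ℝ) + c

theorem IsPiecewiseLinear.comp {f g : I → I} (hf : IsPiecewiseLinear f)
    (hg : IsPiecewiseLinear g) (hmono : StrictMono g) (hsurj : Function.Surjective g) :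
    IsPiecewiseLinear (fun x => f (g x)) := by
  obtain ⟨S, hS, hfS⟩ := hf
  obtain ⟨T, hT, hgT⟩ := hg
  refine ⟨T ∪ g ⁻¹' S, hT.union (hS.preimage hmono.injective.injOn), fun a b hab hd => ?_⟩
  rw [Set.disjoint_union_right] at hd
  obtain ⟨m, c, hm⟩ := hgT a b hab hd.1
  obtain ⟨m', c', hm'⟩ := hfS (g a) (g b) (hmono.monotone hab) (by
    rw [Set.disjoint_left]
    intro y hy hyS
    obtain ⟨x, rfl⟩ := hsurj y
    exact Set.disjoint_left.1 hd.2
      (show x ∈ Set.Ioo a b from ⟨hmono.lt_iff_lt.1 hy.1, hmono.lt_iff_lt.1 hy.2⟩) hyS)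
  refine ⟨m' * m, m' * c + c', fun x hx => ?_⟩
  rw [hm' (g x) ⟨hmono.monotone hx.1, hmono.monotone hx.2⟩, hm x hx]
  ring

theorem IsPiecewiseLinear.symm {f : I ≃ₜ I} (hf : IsPiecewiseLinear f) (hmono : StrictMono f) :
    IsPiecewiseLinear f.symm := by
  obtain ⟨S, hS, hfS⟩ := hf
  have key : ∀ x y : I, f.symm x ≤ f.symm y ↔ x ≤ y := fun x y => by
    rw [← hmono.le_iff_le, f.apply_symm_apply, f.apply_symm_apply]
  have key' : ∀ x y : I, f.symm x < y → x < f y := fun x y h => by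
    simpa using hmono h
  have key'' : ∀ x y : I, x < f.symm y → f x < y := fun x y h => by
    simpa using hmono h
  refine ⟨f '' S, hS.image f, fun a b hab hd => ?_⟩
  obtain ⟨m, c, hm⟩ := hfS (f.symm a) (f.symm b) ((key a b).2 hab) (by
    rw [Set.disjoint_left]
    intro x hx hxS
    exact Set.disjoint_left.1 hd (show f x ∈ Set.Ioo a b from ⟨key' _ _ hx.1, key'' _ _ hx.2⟩)
      ⟨x, hxS, rfl⟩)
  have hm' : ∀ y ∈ Set.Icc a b, (y : ℝ) = m * (f.symm y : ℝ) + c := fun y hy => by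
    have := hm (f.symm y) ⟨(key _ _).2 hy.1, (key _ _).2 hy.2⟩
    rwa [f.apply_symm_apply] at this
  by_cases h0 : m = 0
  · refine ⟨0, f.symm a, fun y hy => ?_⟩
    have h1 := hm' y hy
    have h2 := hm' a ⟨le_rfl, hab⟩
    have : y = a := Subtype.ext (by rw [h1, h2, h0]; ring)
    rw [this]; ring
  · refine ⟨m⁻¹, -(m⁻¹ * c), fun y hy => ?_⟩
    have h1 := hm' y hy
    generalize (f.symm y : ℝ) = z at h1 ⊢
    rw [h1]
    field_simp
    ring

/-- `PL₊(I)`: the group, under composition, of the orientation preserving (that is, strictly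
increasing) piecewise linear homeomorphisms of `I = [0,1]`. -/
def PLPlus : Subgroup (I ≃ₜ I) where
  carrier := {f | StrictMono f ∧ IsPiecewiseLinear f}
  one_mem' := ⟨fun _ _ h => h, ∅, Set.finite_empty, fun _ _ _ _ => ⟨1, 0, fun x _ => by
    show (x : ℝ) = _
    ring⟩⟩
  mul_mem' := fun {f g} hf hg => ⟨hf.1.comp hg.1, hf.2.comp hg.2 hg.1 g.surjective⟩
  inv_mem' := fun {f} hf => ⟨fun x y h => by
    show f.symm x < f.symm y
    rw [← hf.1.lt_iff_lt, f.apply_symm_apply, f.apply_symm_apply]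
    exact h, hf.2.symm hf.1⟩

/-- The support of a group of homeomorphisms of `I`: the set of points moved by some element. -/
def supp (G : Subgroup (I ≃ₜ I)) : Set I := {x | ∃ g ∈ G, g x ≠ x}

theorem smul_mem_supp (G : Subgroup (I ≃ₜ I)) (g : G) {x : I} (hx : x ∈ supp G) :
    (g : I ≃ₜ I) x ∈ supp G := by
  obtain ⟨h, hh, hne⟩ := hx
  refine ⟨g * h * (g : I ≃ₜ I)⁻¹, G.mul_mem (G.mul_mem g.2 hh) (G.inv_mem g.2), fun he => hne ?_⟩
  have h1 : (g : I ≃ₜ I) (h ((g : I ≃ₜ I).symm ((g : I ≃ₜ I) x))) = (g : I ≃ₜ I) x := he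
  rw [Homeomorph.symm_apply_apply] at h1
  exact (g : I ≃ₜ I).injective h1

/-- The action of a group of homeomorphisms of `I` on its support. -/
instance suppMulAction (G : Subgroup (I ≃ₜ I)) : MulAction G (supp G) where
  smul g x := ⟨(g : I ≃ₜ I) x, smul_mem_supp G g x.2⟩
  one_smul _ := rfl
  mul_smul _ _ _ := rfl

/-- The action of `G` on the topological space `X` is locally dense: `X` has no isolated points and,
for every open `U` and `x ∈ U`, the set of the images of `x` under the elements of `G` whose support
(the set of points that they move) is contained in `U` is somewhere dense, that is, its closure has
nonempty interior. -/
def IsLocallyDense (G X : Type*) [Group G] [TopologicalSpace X] [MulAction G X] : Prop :=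
  (∀ x : X, ¬ IsOpen ({x} : Set X)) ∧
    ∀ U : Set X, IsOpen U → ∀ x ∈ U,
      (interior (closure {y : X | ∃ g : G, {z : X | g • z ≠ z} ⊆ U ∧ y = g • x})).Nonempty

/-! This is Rubin's reconstruction argument. For locally dense actions, disjointness of supports
implies the purely algebraic relation `AlgDisjoint`; the converse holds when moved points are never
periodic, which is clear for increasing maps. So φ preserves disjointness of supports, and hence
inclusion of supports up to closure. A point x is then recovered as the only point common to the
closures of the supports of φ g, for g moving x (`Matched`). Local compactness makes this
intersection nonempty (`PreservesDisjoint.exists_matched`), local density makes it a single point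
(`Matched.unique`), and the symmetry of the relation yields the inverse map. -/

open scoped commutatorElement

/-- The set of points of `X` moved by `g`. -/
def moved {G : Type*} (X : Type*) [SMul G X] (g : G) : Set X := {x | g • x ≠ x}

/-! ### Supports and commutators -/

section Moved

variable {G X : Type*} [Group G] [MulAction G X]

theorem mem_moved {g : G} {x : X} : x ∈ moved X g ↔ g • x ≠ x := Iff.rfl

theorem smul_mem_moved_of_commute {g k : G} (h : Commute g k) {x : X} (hx : x ∈ moved X k) :
    g • x ∈ moved X k := by
  rw [mem_moved, smul_smul, ← h.eq, mul_smul]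
  exact fun e => hx (smul_left_cancel g e)

theorem commute_of_disjoint_moved [FaithfulSMul G X] {f g : G}
    (h : Disjoint (moved X f) (moved X g)) : Commute f g := by
  refine FaithfulSMul.eq_of_smul_eq_smul (α := X) fun x => ?_
  have key : ∀ y : X, f • y = y ∨ g • y = y := fun y => by
    by_contra! hy
    exact Set.disjoint_left.1 h hy.1 hy.2
  rw [mul_smul, mul_smul]
  by_cases hf : f • x = x
  · rw [hf]
    rcases key (g • x) with h1 | h1
    · exact h1
    · rw [smul_left_cancel g h1, hf]
  · rw [(key x).resolve_left hf]
    rcases key (f • x) with h1 | h1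
    · exact absurd (smul_left_cancel f h1) hf
    · exact h1.symm

theorem exists_moved_of_ne_one [FaithfulSMul G X] {g : G} (hg : g ≠ 1) :
    (moved X g).Nonempty := by
  by_contra hne
  refine hg (FaithfulSMul.eq_of_smul_eq_smul (α := X) fun x => ?_)
  by_contra hx
  exact hne ⟨x, by rwa [one_smul] at hx⟩

theorem ne_one_of_mem_moved {g : G} {x : X} (hx : x ∈ moved X g) : g ≠ 1 := by
  rintro rfl
  exact hx (one_smul _ _)

theorem moved_commutator_left {a b : G} {y : X} (hy : y ∈ moved X ⁅a, b⁆) :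
    y ∈ moved X a ∨ b⁻¹ • y ∈ moved X a := by
  by_contra! h
  simp only [mem_moved, not_not] at h
  apply hy
  rw [commutatorElement_def, mul_smul, mul_smul, mul_smul,
    inv_smul_eq_iff.2 h.2.symm, smul_inv_smul, h.1]

theorem moved_commutator_right {a b : G} {y : X} (hy : y ∈ moved X ⁅a, b⁆) :
    y ∈ moved X b ∨ a⁻¹ • y ∈ moved X b := by
  by_contra! h
  simp only [mem_moved, not_not] at h
  apply hy
  rw [commutatorElement_def, mul_smul, mul_smul, mul_smul,
    inv_smul_eq_iff.2 h.1.symm, h.2, smul_inv_smul]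

end Moved

/-! ### Locally dense actions -/

section LocallyDense

variable {G X : Type*} [Group G] [TopologicalSpace X] [T2Space X] [MulAction G X]

/-- Otherwise the local orbit of x is {x}, and its nonempty interior makes x isolated. -/
theorem IsLocallyDense.exists_moved_subset (hd : IsLocallyDense G X) {U : Set X} (hU : IsOpen U)
    {x : X} (hx : x ∈ U) : ∃ g : G, moved X g ⊆ U ∧ x ∈ moved X g := by
  by_contra! h
  have hs : {y : X | ∃ g : G, {z : X | g • z ≠ z} ⊆ U ∧ y = g • x} = {x} := by
    refine Set.eq_singleton_iff_unique_mem.2 ⟨⟨1, ?_, (one_smul _ _).symm⟩, ?_⟩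
    · intro z hz
      exact absurd (one_smul _ _) hz
    · rintro y ⟨g, hg, rfl⟩
      exact not_not.1 (h g hg)
  have hi := hd.2 U hU x hx
  rw [hs, closure_singleton] at hi
  obtain ⟨y, hy⟩ := hi
  have hyx : y = x := Set.mem_singleton_iff.1 (interior_subset hy)
  rw [hyx] at hy
  refine hd.1 x ?_
  rw [← Set.Subset.antisymm interior_subset (Set.singleton_subset_iff.2 hy)]
  exact isOpen_interior

theorem isOpen_moved [ContinuousConstSMul G X] (g : G) : IsOpen (moved X g) :=
  isOpen_ne_fun (continuous_const_smul g) continuous_id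

theorem exists_isOpen_displaced [ContinuousConstSMul G X] {x : X} (s : Finset G)
    (hs : ∀ a ∈ s, a • x ≠ x) :
    ∃ U : Set X, IsOpen U ∧ x ∈ U ∧ ∀ a ∈ s, ∀ y ∈ U, a • y ∉ U := by
  classical
  induction s using Finset.induction_on with
  | empty => exact ⟨Set.univ, isOpen_univ, trivial, by simp⟩
  | insert a s _ ih =>
    obtain ⟨U, hU, hxU, hUs⟩ := ih fun b hb => hs b (Finset.mem_insert_of_mem hb)
    obtain ⟨A, B, hA, hB, hxA, hxB, hAB⟩ := t2_separation (hs a (Finset.mem_insert_self a s))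
    refine ⟨U ∩ (B ∩ (a • ·) ⁻¹' A),
      hU.inter (hB.inter (hA.preimage (continuous_const_smul a))), ⟨hxU, hxB, hxA⟩, ?_⟩
    intro b hb y hy hby
    rcases Finset.mem_insert.1 hb with rfl | hb
    · exact Set.disjoint_left.1 hAB hy.2.2 hby.2.1
    · exact hUs b hb y hy.1 hby.1

theorem exists_isOpen_displaced_single [ContinuousConstSMul G X] {x : X} {a : G}
    (ha : a • x ≠ x) : ∃ U : Set X, IsOpen U ∧ x ∈ U ∧ ∀ y ∈ U, a • y ∉ U := by
  simpa using exists_isOpen_displaced {a} (x := x) (by simpa using ha)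

theorem IsLocallyDense.moved_subset_closure_iff [ContinuousConstSMul G X]
    (hd : IsLocallyDense G X) {f g : G} :
    moved X f ⊆ closure (moved X g) ↔
      ∀ k : G, Disjoint (moved X k) (moved X g) → Disjoint (moved X k) (moved X f) := by
  refine ⟨fun h k hk => (hk.closure_right (isOpen_moved k)).mono_right h, fun h x hx => ?_⟩
  by_contra hxg
  obtain ⟨k, hk, hkx⟩ := hd.exists_moved_subset isClosed_closure.isOpen_compl hxg
  have hkg : Disjoint (moved X k) (moved X g) :=
    Set.disjoint_left.2 fun y hy hy' => hk hy (subset_closure hy')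
  exact Set.disjoint_left.1 (h k hkg) hkx hx

end LocallyDense

/-! ### Disjointness of supports in the language of groups -/

/-- Rubin's algebraic disjointness of group elements. -/
def AlgDisjoint {G : Type*} [Group G] (f g : G) : Prop :=
  ∀ h : G, ¬ Commute f h → ∃ f₁ f₂ : G, Commute f₁ g ∧ Commute f₂ g ∧
    ⁅f₁, ⁅f₂, h⁆⁆ ≠ 1 ∧ Commute ⁅f₁, ⁅f₂, h⁆⁆ g

theorem AlgDisjoint.map {G H : Type*} [Group G] [Group H] (φ : G ≃* H) {f g : G}
    (hfg : AlgDisjoint f g) : AlgDisjoint (φ f) (φ g) := by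
  intro h hh
  obtain ⟨h, rfl⟩ := φ.surjective h
  obtain ⟨f₁, f₂, h₁, h₂, h₃, h₄⟩ := hfg h fun hc => hh (hc.map φ)
  refine ⟨φ f₁, φ f₂, h₁.map φ, h₂.map φ, ?_, ?_⟩
  · rw [← map_commutatorElement, ← map_commutatorElement]
    exact fun e => h₃ (φ.injective (e.trans (map_one φ).symm))
  · rw [← map_commutatorElement, ← map_commutatorElement]
    exact h₄.map φ

section Algebraic

variable {G X : Type*} [Group G] [TopologicalSpace X] [T2Space X] [MulAction G X]
  [ContinuousConstSMul G X] [FaithfulSMul G X]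

/-- Inside the support of f, choose f₂ living on a set U displaced by h, then f₁ living on a smaller
set displaced by f₂. On U the commutator ⁅f₂, h⁆ acts as f₂, which does not commute with f₁. -/
theorem IsLocallyDense.algDisjoint_of_disjoint (hd : IsLocallyDense G X) {f g : G}
    (hfg : Disjoint (moved X f) (moved X g)) : AlgDisjoint f g := by
  intro h hh
  obtain ⟨x, hxf, hxh⟩ := Set.not_disjoint_iff.1 fun hdis => hh (commute_of_disjoint_moved (X := X) hdis)
  obtain ⟨V, hV, hxV, hVh⟩ := exists_isOpen_displaced_single hxh
  set U := V ∩ moved X f with hUdef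
  have hU : IsOpen U := hV.inter (isOpen_moved f)
  have hxU : x ∈ U := ⟨hxV, hxf⟩
  obtain ⟨f₂, hf₂, hf₂x⟩ := hd.exists_moved_subset hU hxU
  obtain ⟨W, hW, hxW, hWf⟩ := exists_isOpen_displaced_single hf₂x
  obtain ⟨f₁, hf₁, hf₁x⟩ := hd.exists_moved_subset (hW.inter hU) (x := x) ⟨hxW, hxU⟩
  have hdis : ∀ k : G, moved X k ⊆ U → Commute k g := fun k hk =>
    commute_of_disjoint_moved (hfg.mono_left (hk.trans Set.inter_subset_right))
  have hc : ∀ y ∈ U, ⁅f₂, h⁆ • y = f₂ • y := by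
    intro y hy
    have h1 : h⁻¹ • y ∉ moved X f₂ := fun h2 => by
      have := hVh _ (hf₂ h2).1
      rw [smul_inv_smul] at this
      exact this hy.1
    rw [mem_moved, not_not] at h1
    rw [commutatorElement_def, mul_smul, mul_smul, mul_smul, inv_smul_eq_iff.2 h1.symm,
      smul_inv_smul]
  refine ⟨f₁, f₂, hdis _ (hf₁.trans Set.inter_subset_right), hdis _ hf₂, ?_, hdis _ ?_⟩
  · intro hone
    have hcomm : f₁ * ⁅f₂, h⁆ = ⁅f₂, h⁆ * f₁ := commutatorElement_eq_one_iff_mul_comm.1 hone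
    have h1 := congrArg (· • x) hcomm
    simp only [mul_smul] at h1
    have hf₁U : f₁ • x ∈ U := (hf₁ (smul_mem_moved_of_commute (Commute.refl f₁) hf₁x)).2
    rw [hc x hxU, hc _ hf₁U] at h1
    have h2 : f₁ • f₂ • x = f₂ • x := by
      by_contra hne
      exact hWf x hxW (hf₁ hne).1
    rw [h2] at h1
    exact hf₁x (smul_left_cancel f₂ h1).symm
  -- The support of ⁅f₁, ⁅f₂, h⁆⁆ stays inside U, hence inside that of f.
  · intro y hy
    rcases moved_commutator_left hy with h1 | h1
    · exact (hf₁ h1).2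
    · obtain ⟨hzW, hzU⟩ := hf₁ h1
      have h3 := hc _ hzU
      rw [smul_inv_smul] at h3
      rw [h3]
      refine hf₂ (smul_mem_moved_of_commute (Commute.refl f₂) fun hfix => ?_)
      exact hWf _ hzW (by rw [hfix]; exact hzW)

/-- Pigeonhole: for h supported in a small U, the double commutator is supported in four translates
of U by elements commuting with g. It commutes with g too, so its support contains five points p, …,
g⁴p; two lie in one translate, though g, …, g⁴ displace U. -/
theorem IsLocallyDense.disjoint_of_algDisjoint (hd : IsLocallyDense G X)
    (hper : ∀ (g : G) (x : X), g • x ≠ x → ∀ n : ℕ, 0 < n → g ^ n • x ≠ x) {f g : G}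
    (hfg : AlgDisjoint f g) : Disjoint (moved X f) (moved X g) := by
  classical
  rw [Set.disjoint_left]
  intro x hxf hxg
  obtain ⟨U, hU, hxU, hUs⟩ := exists_isOpen_displaced
    (insert f ((Finset.Icc 1 4).image (g ^ ·))) (x := x) (by
      intro a ha
      rcases Finset.mem_insert.1 ha with rfl | ha
      · exact hxf
      · obtain ⟨n, hn, rfl⟩ := Finset.mem_image.1 ha
        exact hper g x hxg n (Finset.mem_Icc.1 hn).1)
  have hUf : ∀ y ∈ U, f • y ∉ U := hUs f (Finset.mem_insert_self _ _)
  have hUg : ∀ n : ℕ, 1 ≤ n → n ≤ 4 → ∀ y ∈ U, g ^ n • y ∉ U := fun n h1 h4 =>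
    hUs _ (Finset.mem_insert_of_mem (Finset.mem_image_of_mem _ (Finset.mem_Icc.2 ⟨h1, h4⟩)))
  obtain ⟨h, hhU, hhx⟩ := hd.exists_moved_subset hU hxU
  obtain ⟨f₁, f₂, hf₁, hf₂, hne, hk⟩ := hfg h (by
    intro hc
    have h1 : h • f • x = f • x := by
      by_contra hne
      exact hUf x hxU (hhU hne)
    have h2 := congrArg (· • x) hc.eq
    simp only [mul_smul] at h2
    rw [h1] at h2
    exact hhx (smul_left_cancel f h2))
  obtain ⟨p, hp⟩ := exists_moved_of_ne_one (X := X) hne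
  let c : Fin 4 → G := ![1, f₁, f₂, f₁ * f₂]
  have hcg : ∀ j, Commute (c j) g := by
    intro j
    fin_cases j
    · exact Commute.one_left g
    · exact hf₁
    · exact hf₂
    · exact hf₁.mul_left hf₂
  have hcover : ∀ i : Fin 5, ∃ j, (c j)⁻¹ • g ^ (i : ℕ) • p ∈ U := by
    intro i
    have hq := smul_mem_moved_of_commute (hk.symm.pow_left (i : ℕ)) hp
    rcases moved_commutator_right hq with h1 | h1 <;>
      rcases moved_commutator_right h1 with h2 | h2
    · exact ⟨0, by simpa [c] using hhU h2⟩
    · exact ⟨2, by simpa [c] using hhU h2⟩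
    · exact ⟨1, by simpa [c] using hhU h2⟩
    · exact ⟨3, by simpa [c, mul_smul] using hhU h2⟩
  choose j hj using hcover
  obtain ⟨a, b, hab, hjab⟩ := Fintype.exists_ne_map_eq_of_card_lt j (by simp)
  have key : ∀ a b : Fin 5, a < b → j a ≠ j b := by
    intro a b hlt heq
    have hlt' : (a : ℕ) < b := hlt
    refine hUg (b - a) (by omega) (by omega) _ (hj a) ?_
    rw [smul_smul, ((hcg (j a)).symm.pow_left _).inv_right.eq, mul_smul, smul_smul (g ^ _),
      ← pow_add, Nat.sub_add_cancel hlt'.le, heq]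
    exact hj b
  rcases lt_or_gt_of_ne hab with h1 | h1
  · exact key a b h1 hjab
  · exact key b a h1 hjab.symm

end Algebraic

/-! ### Matching points through supports -/

section Matching

variable {G H X Y : Type*} [Group G] [MulAction G X] [Group H] [MulAction H Y]

/-- `φ` preserves and reflects disjointness of supports. -/
def PreservesDisjoint (X Y : Type*) [MulAction G X] [MulAction H Y] (φ : G ≃* H) : Prop :=
  ∀ f g : G, Disjoint (moved X f) (moved X g) ↔ Disjoint (moved Y (φ f)) (moved Y (φ g))

theorem PreservesDisjoint.symm {φ : G ≃* H} (hφ : PreservesDisjoint X Y φ) :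
    PreservesDisjoint Y X φ.symm := by
  intro f g
  rw [hφ, φ.apply_symm_apply, φ.apply_symm_apply]

/-- The points `x` and `y` correspond under `φ`: whenever `g` moves `x` and `h` moves `y`, the
supports of `φ g` and `h` meet. -/
def Matched (φ : G ≃* H) (x : X) (y : Y) : Prop :=
  ∀ (g : G) (h : H), x ∈ moved X g → y ∈ moved Y h → ¬ Disjoint (moved Y (φ g)) (moved Y h)

theorem Matched.symm {φ : G ≃* H} (hφ : PreservesDisjoint X Y φ) {x : X} {y : Y}
    (h : Matched φ x y) : Matched φ.symm y x := by
  intro b a hb ha hdis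
  rw [hφ, φ.apply_symm_apply] at hdis
  exact h a b ha hb hdis.symm

theorem smul_mem_moved_iff {a g : G} {x : X} :
    a • x ∈ moved X g ↔ x ∈ moved X (a⁻¹ * g * a) := by
  rw [mem_moved, mem_moved, mul_smul, mul_smul, ne_eq, ne_eq, inv_smul_eq_iff]

theorem Matched.smul {φ : G ≃* H} {x : X} {y : Y} (h : Matched φ x y) (a : G) :
    Matched φ (a • x) (φ a • y) := by
  intro g b hg hb
  obtain ⟨z, hz₁, hz₂⟩ := Set.not_disjoint_iff.1
    (h _ _ (smul_mem_moved_iff.1 hg) (smul_mem_moved_iff.1 hb))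
  refine Set.not_disjoint_iff.2 ⟨φ a • z, ?_, smul_mem_moved_iff.2 hz₂⟩
  rw [smul_mem_moved_iff]
  simpa using hz₁

theorem matched_of_equivariant {φ : G ≃* H} {ψ : X → Y} (hψ : Function.Injective ψ)
    (he : ∀ (g : G) (x : X), ψ (g • x) = φ g • ψ x) (x : X) : Matched φ x (ψ x) := by
  intro g h hg hh
  refine Set.not_disjoint_iff.2 ⟨ψ x, ?_, hh⟩
  rw [mem_moved, ← he]
  exact hψ.ne hg

variable [TopologicalSpace Y] [T2Space Y]

theorem Matched.mem_closure (hd : IsLocallyDense H Y) {φ : G ≃* H} {x : X} {y : Y}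
    (h : Matched φ x y) {g : G} (hg : x ∈ moved X g) : y ∈ closure (moved Y (φ g)) := by
  by_contra hy
  obtain ⟨k, hk, hky⟩ := hd.exists_moved_subset isClosed_closure.isOpen_compl hy
  exact h g k hg hky (Set.disjoint_left.2 fun z hz hz' => hk hz' (subset_closure hz))

variable [ContinuousConstSMul H Y]

theorem matched_of_mem_closure {φ : G ≃* H} {x : X} {y : Y}
    (h : ∀ g, x ∈ moved X g → y ∈ closure (moved Y (φ g))) : Matched φ x y := by
  intro g k hg hk hdis
  exact Set.disjoint_left.1 (hdis.closure_left (isOpen_moved k)) (h g hg) hk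

variable [TopologicalSpace X] [T2Space X] [ContinuousConstSMul G X]

theorem PreservesDisjoint.subset_closure_iff {φ : G ≃* H} (hφ : PreservesDisjoint X Y φ)
    (hG : IsLocallyDense G X) (hH : IsLocallyDense H Y) {f g : G} :
    moved X f ⊆ closure (moved X g) ↔ moved Y (φ f) ⊆ closure (moved Y (φ g)) := by
  rw [hG.moved_subset_closure_iff, hH.moved_subset_closure_iff]
  refine ⟨fun h k => ?_, fun h k => ?_⟩
  · obtain ⟨k, rfl⟩ := φ.surjective k
    rw [← hφ, ← hφ]
    exact h k
  · rw [hφ, hφ]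
    exact h (φ k)

/-- Otherwise every a with φ a supported in V fixes x, so the whole local orbit of y is matched with
x. That orbit is somewhere dense, which forces one nontrivial support into the closure of every
support around x; such closures shrink to x. -/
theorem Matched.exists_moved_subset [FaithfulSMul G X] {φ : G ≃* H}
    (hφ : PreservesDisjoint X Y φ) (hG : IsLocallyDense G X) (hH : IsLocallyDense H Y)
    {x : X} {y : Y} (h : Matched φ x y) {V : Set Y} (hV : IsOpen V) (hy : y ∈ V) :
    ∃ g : G, x ∈ moved X g ∧ moved Y (φ g) ⊆ V := by
  by_contra! hcon
  obtain ⟨w, hw⟩ := hH.2 V hV y hy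
  set T := {z : Y | ∃ k : H, {z : Y | k • z ≠ z} ⊆ V ∧ z = k • y}
  have hT : ∀ g, x ∈ moved X g → interior (closure T) ⊆ closure (moved Y (φ g)) := by
    intro g hg
    refine interior_subset.trans (closure_minimal ?_ isClosed_closure)
    rintro _ ⟨k, hk, rfl⟩
    obtain ⟨a, rfl⟩ := φ.surjective k
    have hfix : a • x = x := by
      by_contra hne
      exact hcon a hne hk
    have h1 := h.smul a
    rw [hfix] at h1
    exact h1.mem_closure hH hg
  obtain ⟨k, hk, hkw⟩ := hH.exists_moved_subset isOpen_interior hw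
  obtain ⟨a, rfl⟩ := φ.surjective k
  have ha : ∀ g, x ∈ moved X g → moved X a ⊆ closure (moved X g) := fun g hg =>
    (hφ.subset_closure_iff hG hH).2 (hk.trans (hT g hg))
  have ha1 : a ≠ 1 := by
    rintro rfl
    exact ne_one_of_mem_moved hkw (map_one φ)
  obtain ⟨z, hza, hzx⟩ : ∃ z ∈ moved X a, z ≠ x := by
    obtain ⟨z, hz⟩ := exists_moved_of_ne_one (X := X) ha1
    by_cases hzx : z = x
    · exact ⟨a • z, smul_mem_moved_of_commute (Commute.refl a) hz, fun e => hz (e.trans hzx.symm)⟩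
    · exact ⟨z, hz, hzx⟩
  obtain ⟨A, B, hA, hB, hzA, hxB, hAB⟩ := t2_separation hzx
  obtain ⟨g, hg, hgx⟩ := hG.exists_moved_subset hB hxB
  exact Set.disjoint_left.1 (hAB.closure_right hA) hzA (closure_mono hg (ha g hgx hza))

theorem Matched.unique [FaithfulSMul G X] {φ : G ≃* H}
    (hφ : PreservesDisjoint X Y φ) (hG : IsLocallyDense G X) (hH : IsLocallyDense H Y)
    {x : X} {y z : Y} (hy : Matched φ x y) (hz : Matched φ x z) : y = z := by
  by_contra hne
  obtain ⟨A, B, hA, hB, hyA, hzB, hAB⟩ := t2_separation hne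
  obtain ⟨g, hgx, hg⟩ := hy.exists_moved_subset hφ hG hH hA hyA
  exact Set.disjoint_left.1 (hAB.symm.closure_right hB) hzB
    (closure_mono hg (hz.mem_closure hH hgx))

theorem PreservesDisjoint.exists_isCompact_closure [FaithfulSMul G X] [LocallyCompactSpace Y]
    {φ : G ≃* H} (hφ : PreservesDisjoint X Y φ) (hG : IsLocallyDense G X)
    (hH : IsLocallyDense H Y) (x : X) :
    ∃ g : G, x ∈ moved X g ∧ IsCompact (closure (moved Y (φ g))) := by
  obtain ⟨w, hw⟩ := hG.2 Set.univ isOpen_univ x trivial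
  obtain ⟨k, hk, hkw⟩ := hG.exists_moved_subset isOpen_interior hw
  obtain ⟨y, hy⟩ : (moved Y (φ k)).Nonempty := by
    by_contra hne
    rw [Set.not_nonempty_iff_eq_empty] at hne
    have h1 := (hφ k k).2 (by rw [hne]; exact disjoint_bot_left)
    exact Set.disjoint_left.1 h1 hkw hkw
  obtain ⟨K, hK, hyK, hKk⟩ := exists_compact_subset (isOpen_moved (φ k)) hy
  obtain ⟨b, hb, hby⟩ := hH.exists_moved_subset isOpen_interior hyK
  obtain ⟨a, rfl⟩ := φ.surjective b
  obtain ⟨z, hz⟩ : (moved X a).Nonempty := by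
    refine exists_moved_of_ne_one ?_
    rintro rfl
    exact ne_one_of_mem_moved hby (map_one φ)
  have hak : moved X a ⊆ closure (moved X k) := (hφ.subset_closure_iff hG hH).2
    ((hb.trans (interior_subset.trans hKk)).trans subset_closure)
  -- The support of a meets the local orbit of x, so conjugating a by a suitable c makes it move x.
  obtain ⟨u, hua, huk⟩ := mem_closure_iff.1 (hak hz) _ (isOpen_moved a) hz
  obtain ⟨_, hca, c, -, rfl⟩ := mem_closure_iff.1 (interior_subset (hk huk)) _ (isOpen_moved a) hua
  refine ⟨c⁻¹ * a * c, smul_mem_moved_iff.1 hca, ?_⟩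
  have hsub : moved Y (φ (c⁻¹ * a * c)) ⊆ (fun y => φ c • y) ⁻¹' K := by
    intro y hy
    rw [map_mul, map_mul, map_inv, ← smul_mem_moved_iff] at hy
    exact interior_subset (s := K) (hb hy)
  have hcomp : IsCompact ((fun y => φ c • y) ⁻¹' K) :=
    (Homeomorph.smul (φ c)).isCompact_preimage.2 hK
  exact hcomp.of_isClosed_subset isClosed_closure (closure_minimal hsub hcomp.isClosed)

theorem PreservesDisjoint.exists_matched [FaithfulSMul G X] [LocallyCompactSpace Y]
    {φ : G ≃* H} (hφ : PreservesDisjoint X Y φ) (hG : IsLocallyDense G X)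
    (hH : IsLocallyDense H Y) (x : X) : ∃ y : Y, Matched φ x y := by
  obtain ⟨g₀, hg₀, hK⟩ := hφ.exists_isCompact_closure hG hH x
  have hmono : ∀ {f g : G}, moved X f ⊆ moved X g →
      closure (moved Y (φ f)) ⊆ closure (moved Y (φ g)) := fun h =>
    closure_minimal ((hφ.subset_closure_iff hG hH).1 (h.trans subset_closure)) isClosed_closure
  have hinter : ∀ f g : G, x ∈ moved X f → x ∈ moved X g →
      ∃ k : G, x ∈ moved X k ∧ moved X k ⊆ moved X f ∧ moved X k ⊆ moved X g := by
    intro f g hf hg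
    obtain ⟨k, hk, hkx⟩ := hG.exists_moved_subset ((isOpen_moved f).inter (isOpen_moved g))
      (x := x) ⟨hf, hg⟩
    exact ⟨k, hkx, hk.trans Set.inter_subset_left, hk.trans Set.inter_subset_right⟩
  let ι := {g : G // x ∈ moved X g ∧ moved X g ⊆ moved X g₀}
  have : Nonempty ι := ⟨⟨g₀, hg₀, subset_rfl⟩⟩
  obtain ⟨y, hy⟩ := IsCompact.nonempty_iInter_of_directed_nonempty_isCompact_isClosed
    (fun i : ι => closure (moved Y (φ i.1)))
    (by
      rintro ⟨f, hf, hf₀⟩ ⟨g, hg, hg₀⟩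
      obtain ⟨k, hk, hkf, hkg⟩ := hinter f g hf hg
      exact ⟨⟨k, hk, hkf.trans hf₀⟩, hmono hkf, hmono hkg⟩)
    (by
      rintro ⟨f, hf, -⟩
      refine Set.Nonempty.closure ?_
      by_contra hne
      rw [Set.not_nonempty_iff_eq_empty] at hne
      have h1 := (hφ f f).2 (by rw [hne]; exact disjoint_bot_left)
      exact Set.disjoint_left.1 h1 hf hf)
    (fun i => hK.of_isClosed_subset isClosed_closure (hmono i.2.2))
    (fun i => isClosed_closure)
  refine ⟨y, matched_of_mem_closure fun g hg => ?_⟩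
  obtain ⟨k, hk, hkg, hkg₀⟩ := hinter g g₀ hg hg₀
  exact hmono hkg (Set.mem_iInter.1 hy ⟨k, hk, hkg₀⟩)

/-- Supports around x are neighbourhoods of x, and their images under ψ lie in closures that can be
made arbitrarily small. -/
theorem continuous_of_matched [FaithfulSMul G X] {φ : G ≃* H}
    (hφ : PreservesDisjoint X Y φ) (hG : IsLocallyDense G X) (hH : IsLocallyDense H Y)
    [LocallyCompactSpace Y] {ψ : X → Y} (hψ : ∀ x, Matched φ x (ψ x)) : Continuous ψ := by
  refine continuous_iff_continuousAt.2 fun x V hV => ?_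
  obtain ⟨K, hKx, hK, hKV⟩ := exists_mem_nhds_isClosed_subset hV
  obtain ⟨g, hgx, hg⟩ := (hψ x).exists_moved_subset hφ hG hH isOpen_interior
    (mem_interior_iff_mem_nhds.2 hKx)
  refine Filter.mem_map.2 (Filter.mem_of_superset ((isOpen_moved g).mem_nhds hgx) fun z hz => ?_)
  exact hKV (closure_minimal (hg.trans interior_subset) hK ((hψ z).mem_closure hH hz))

theorem PreservesDisjoint.existsUnique_homeomorph [FaithfulSMul G X] [FaithfulSMul H Y]
    [LocallyCompactSpace X] [LocallyCompactSpace Y]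
    {φ : G ≃* H} (hφ : PreservesDisjoint X Y φ) (hG : IsLocallyDense G X)
    (hH : IsLocallyDense H Y) :
    ∃! ψ : X ≃ₜ Y, ∀ (g : G) (x : X), ψ (g • x) = φ g • ψ x := by
  choose ψ hψ using hφ.exists_matched hG hH
  choose θ hθ using hφ.symm.exists_matched hH hG
  have huniq : ∀ {x y z}, Matched φ x y → Matched φ x z → y = z := fun h₁ h₂ =>
    Matched.unique hφ hG hH h₁ h₂
  refine ⟨⟨⟨ψ, θ, fun x => ?_, fun y => ?_⟩, continuous_of_matched hφ hG hH hψ,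
    continuous_of_matched hφ.symm hH hG hθ⟩, ?_, ?_⟩
  · exact (hθ (ψ x)).unique hφ.symm hH hG ((hψ x).symm hφ)
  · exact huniq (hψ (θ y)) ((hθ y).symm hφ.symm)
  · intro g x
    exact huniq (hψ (g • x)) ((hψ x).smul g)
  · intro ψ' hψ'
    ext x
    exact huniq (matched_of_equivariant ψ'.injective hψ' x) (hψ x)

end Matching

/-- **Rubin's theorem** for groups without periodic moved points. -/
theorem existsUnique_equivariant_homeomorph {G H X Y : Type*} [Group G] [MulAction G X] [Group H]
    [MulAction H Y] [TopologicalSpace X] [T2Space X] [LocallyCompactSpace X]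
    [ContinuousConstSMul G X] [FaithfulSMul G X] [TopologicalSpace Y] [T2Space Y]
    [LocallyCompactSpace Y] [ContinuousConstSMul H Y] [FaithfulSMul H Y]
    (hG : IsLocallyDense G X) (hH : IsLocallyDense H Y)
    (hGp : ∀ (g : G) (x : X), g • x ≠ x → ∀ n : ℕ, 0 < n → g ^ n • x ≠ x)
    (hHp : ∀ (h : H) (y : Y), h • y ≠ y → ∀ n : ℕ, 0 < n → h ^ n • y ≠ y) (φ : G ≃* H) :
    ∃! ψ : X ≃ₜ Y, ∀ (g : G) (x : X), ψ (g • x) = φ g • ψ x := by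
  refine PreservesDisjoint.existsUnique_homeomorph (fun f g => ⟨fun h => ?_, fun h => ?_⟩) hG hH
  · exact hH.disjoint_of_algDisjoint hHp ((hG.algDisjoint_of_disjoint h).map φ)
  · have h1 := (hH.algDisjoint_of_disjoint h).map φ.symm
    rw [φ.symm_apply_apply, φ.symm_apply_apply] at h1
    exact hG.disjoint_of_algDisjoint hGp h1

/-! ### Groups of increasing homeomorphisms of the interval -/

section Interval

instance supp_continuousConstSMul (G : Subgroup (I ≃ₜ I)) : ContinuousConstSMul G (supp G) where
  continuous_const_smul g :=
    ((g : I ≃ₜ I).continuous.comp continuous_subtype_val).subtype_mk _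

instance supp_faithfulSMul (G : Subgroup (I ≃ₜ I)) : FaithfulSMul G (supp G) where
  eq_of_smul_eq_smul {f g} h := by
    refine Subtype.ext (Homeomorph.ext fun x => ?_)
    by_cases hx : x ∈ supp G
    · exact congrArg Subtype.val (h ⟨x, hx⟩)
    · have hfix : ∀ k : G, (k : I ≃ₜ I) x = x := fun k => by
        by_contra hk
        exact hx ⟨k, k.2, hk⟩
      rw [hfix f, hfix g]

theorem isOpen_supp (G : Subgroup (I ≃ₜ I)) : IsOpen (supp G) := by
  have h : supp G = ⋃ g ∈ G, {x | g x ≠ x} := by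
    ext x
    simp [supp]
  rw [h]
  exact isOpen_biUnion fun g _ => isOpen_ne_fun g.continuous continuous_id

theorem pow_smul_ne_of_strictMono {G : Subgroup (I ≃ₜ I)}
    (hG : ∀ g ∈ G, StrictMono g) (g : G) (x : supp G) (hx : g • x ≠ x) (n : ℕ) (hn : 0 < n) :
    g ^ n • x ≠ x := by
  have hm : StrictMono fun y : supp G => g • y := fun a b hab => hG g g.2 hab
  rw [← smul_iterate_apply]
  -- The iterates of a moved point under an increasing map are strictly monotone.
  rcases lt_or_gt_of_ne hx with h | h
  · exact (hm.strictAnti_iterate_of_map_lt h hn).ne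
  · exact (hm.strictMono_iterate_of_lt_map h hn).ne'

end Interval

theorem corollary6 (G H : Subgroup (I ≃ₜ I)) (hG : G ≤ PLPlus) (hH : H ≤ PLPlus)
    (hG₁ : G ≠ ⊥) (hH₁ : H ≠ ⊥)
    (hGd : IsLocallyDense G (supp G)) (hHd : IsLocallyDense H (supp H))
    (φ : G ≃* H) :
    ∃! ψ : supp G ≃ₜ supp H, ∀ (g : G) (x : supp G), ψ (g • x) = φ g • ψ x := by
  have := (isOpen_supp G).locallyCompactSpace
  have := (isOpen_supp H).locallyCompactSpace
  exact existsUnique_equivariant_homeomorph hGd hHd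
    (pow_smul_ne_of_strictMono fun g hg => (hG hg).1)
    (pow_smul_ne_of_strictMono fun h hh => (hH hh).1) φ
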